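/- Let $d\in\mathbb N$ and let $\mathbb W$ be the Weyl $C^*$-algebra over $\mathbb R^d$: the completion of the Weyl $*$-algebra $\mathbb W_0$ in the norm $\|a\|=\sup_\rho\|\rho(a)\|$, where $\rho$ runs over the $*$-representations of $\mathbb W_0$ by bounded operators on Hilbert spaces. Here $\mathbb W_0$ is the complex $*$-algebra with linear basis the monomials $u_\alpha v_\beta$ ($\alpha,\beta\in\mathbb R^d$) and relations $u_\alpha v_\beta=e^{i\alpha\cdot\beta}v_\beta u_\alpha$, $u_\alpha u_{\alpha'}=u_{\alpha+\alpha'}$, $v_\beta v_{\beta'}=v_{\beta+\beta'}$, $u_\alpha^*=u_{-\alpha}$, $v_\beta^*=v_{-\beta}$. The states of $\mathbb W$ (positive normalized linear functionals) carry the weak-$*$ topology, and pure states are the extreme points of the set of states. For $\lambda,\alpha\in\mathbb R^d$ let $\tau_\lambda(a)=v_\lambda a v_\lambda^*$ and $\theta_\alpha(a)=u_\alpha a u_\alpha^*$ be the space and momentum translations of $\mathbb W$. Let $\mathcal P$ be the set of plane-wave states, that is, of the pure states $\omega$ of $\mathbb W$ such that $\omega\circ\tau_\lambda=\omega$ for all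 $\lambda\in\mathbb R^d$ and such that $s\mapsto\omega(u_\alpha v_{s\beta})$ is continuous on $\mathbb R$ for all $\alpha,\beta\in\mathbb R^d$. Two states $\omega,\omega'\in\mathcal P$ are called automorphically equivalent inside $\mathcal P$ if there is a map $[0,1]\ni t\mapsto\lambda_t\in\mathrm{Aut}(\mathbb W)$ into the $*$-automorphisms that is strongly continuous ($t\mapsto\lambda_t(a)$ is norm continuous for every $a\in\mathbb W$) and such that $t\mapsto\omega\circ\lambda_t$ is a weak-$*$ continuous path in $\mathcal P$ from $\omega$ to $\omega'$. **Proposition.** The plane-wave states are exactly the functionals $\omega_p$, $p\in\mathbb R^d$, determined by $$\omega_p(u_\alpha v_\beta)=\delta_{\alpha,0}\,e^{-ip\cdot\beta}\qquad(\alpha,\beta\in\mathbb R^d),$$ all of which exist. Every plane-wave state $\omega_p$ is automorphically equivalent, inside $\mathcal P$, to the zero-momentum state $\omega_0$, and the path $\lambda_t=\theta_{tp}$, $t\in[0,1]$, implements this equivalence. -/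

import Mathlib

/-! The Weyl C⋆-algebra over `ℝ^d`, its states, and automorphic equivalence of states. -/

noncomputable section

namespace WeylCCR

open scoped ComplexOrder

/-- The Euclidean space `ℝ^d`. -/
abbrev E (d : ℕ) : Type := EuclideanSpace ℝ (Fin d)

/-- The phase `exp(i x)`, for real `x`. -/
def phase (x : ℝ) : ℂ := Complex.exp (Complex.I * x)

lemma phase_zero : phase 0 = 1 := by simp [phase]

lemma phase_add (x y : ℝ) : phase (x + y) = phase x * phase y := by
  simp [phase, mul_add, Complex.exp_add]

lemma star_phase (x : ℝ) : star (phase x) = phase (-x) := by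
  simp [phase, ← Complex.exp_conj]

/-! ### The Weyl star-algebra -/

/-- The Weyl star-algebra: finite formal complex linear combinations of the monomials
`u_α v_β`, with `(α, β) ∈ ℝ^d × ℝ^d`. -/
def WeylStar (d : ℕ) : Type := (E d × E d) →₀ ℂ

namespace WeylStar

variable {d : ℕ}

instance : AddCommGroup (WeylStar d) := inferInstanceAs (AddCommGroup ((E d × E d) →₀ ℂ))

instance : Module ℂ (WeylStar d) := inferInstanceAs (Module ℂ ((E d × E d) →₀ ℂ))

/-- `mono z c` is `c • u_α v_β` for `z = (α, β)`. -/
def mono (z : E d × E d) : ℂ →ₗ[ℂ] WeylStar d := Finsupp.lsingle z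

lemma induction_mono {p : WeylStar d → Prop} (h0 : p 0) (hadd : ∀ x y, p x → p y → p (x + y))
    (hm : ∀ z c, p (mono z c)) (x : WeylStar d) : p x :=
  Finsupp.induction_linear x h0 (fun f g => hadd f g) (fun z c => hm z c)

lemma smul_mono (r : ℂ) (z : E d × E d) (c : ℂ) : r • mono z c = mono z (r * c) := by
  rw [← map_smul, smul_eq_mul]

/-- The linear map out of the Weyl star-algebra with prescribed values on the monomials. -/
def lift {M : Type} [AddCommGroup M] [Module ℂ M] (f : E d × E d → M) : WeylStar d →ₗ[ℂ] M :=
  Finsupp.lsum ℂ fun z => LinearMap.toSpanSingleton ℂ M (f z)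

lemma lift_mono {M : Type} [AddCommGroup M] [Module ℂ M] (f : E d × E d → M) (z : E d × E d)
    (c : ℂ) : lift f (mono z c) = c • f z := by
  change (Finsupp.lsum ℂ fun z => LinearMap.toSpanSingleton ℂ M (f z)) (Finsupp.single z c) = _
  rw [Finsupp.lsum_single, LinearMap.toSpanSingleton_apply]

/-- The product as a bilinear map, determined by
`(u_α v_β) (u_α' v_β') = exp(-i α'·β) u_(α+α') v_(β+β')`, which is the rule that the Weyl relation
`u_α v_β = exp(i α·β) v_β u_α` and the additivity of `u` and `v` prescribe. -/
def mulHom : WeylStar d →ₗ[ℂ] WeylStar d →ₗ[ℂ] WeylStar d :=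
  lift fun z => lift fun w => mono (z + w) (phase (-(inner ℝ w.1 z.2)))

instance : Mul (WeylStar d) := ⟨fun x y => mulHom x y⟩

lemma mul_def (x y : WeylStar d) : x * y = mulHom x y := rfl

lemma mono_mul_mono (z w : E d × E d) (a b : ℂ) :
    mono z a * mono w b = mono (z + w) (a * b * phase (-(inner ℝ w.1 z.2))) := by
  rw [mul_def, mulHom, lift_mono, LinearMap.smul_apply, lift_mono, smul_mono, smul_mono, mul_assoc]

instance : One (WeylStar d) := ⟨mono 0 1⟩

lemma one_def : (1 : WeylStar d) = mono 0 1 := rfl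

instance : Ring (WeylStar d) where
  __ := (inferInstance : AddCommGroup (WeylStar d))
  left_distrib x y z := by simp only [mul_def, map_add]
  right_distrib x y z := by simp only [mul_def, map_add, LinearMap.add_apply]
  zero_mul x := by simp only [mul_def, map_zero, LinearMap.zero_apply]
  mul_zero x := by simp only [mul_def, map_zero]
  mul_assoc x y z := by
    induction x using induction_mono with
    | h0 => simp only [mul_def, map_zero, LinearMap.zero_apply]
    | hadd x x' h h' =>
      simp only [mul_def, map_add, LinearMap.add_apply] at h h' ⊢
      rw [h, h']
    | hm p a =>
      induction y using induction_mono with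
      | h0 => simp only [mul_def, map_zero, LinearMap.zero_apply]
      | hadd x x' h h' =>
        simp only [mul_def, map_add, LinearMap.add_apply] at h h' ⊢
        rw [h, h']
      | hm q b =>
        induction z using induction_mono with
        | h0 => simp only [mul_def, map_zero]
        | hadd x x' h h' =>
          simp only [mul_def, map_add] at h h' ⊢
          rw [h, h']
        | hm r c =>
          simp only [mono_mul_mono, add_assoc, Prod.fst_add, Prod.snd_add, inner_add_left,
            inner_add_right, neg_add, phase_add]
          congr 1
          ring
  one_mul x := by
    induction x using induction_mono with
    | h0 => simp only [mul_def, map_zero]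
    | hadd x x' h h' => rw [mul_def, map_add, ← mul_def, ← mul_def, h, h']
    | hm p a => simp [one_def, mono_mul_mono, phase_zero]
  mul_one x := by
    induction x using induction_mono with
    | h0 => simp only [mul_def, map_zero, LinearMap.zero_apply]
    | hadd x x' h h' =>
      rw [mul_def, map_add, LinearMap.add_apply, ← mul_def, ← mul_def, h, h']
    | hm p a => simp [one_def, mono_mul_mono, phase_zero]

instance : Algebra ℂ (WeylStar d) :=
  Algebra.ofModule (fun r x y => by simp only [mul_def, map_smul, LinearMap.smul_apply])
    (fun r x y => by simp only [mul_def, map_smul])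

/-- The involution, determined by `(c • u_α v_β)^* = conj c exp(-i α·β) • u_(-α) v_(-β)`, which is
`conj c • v_β^* u_α^*` for `u_α^* = u_(-α)` and `v_β^* = v_(-β)`. -/
def starHom : WeylStar d →+ WeylStar d :=
  Finsupp.liftAddHom fun z => (mono (-z)).toAddMonoidHom.comp
    ((AddMonoidHom.mulRight (phase (-(inner ℝ z.1 z.2)))).comp (starAddEquiv : ℂ ≃+ ℂ).toAddMonoidHom)

instance : Star (WeylStar d) := ⟨fun x => starHom x⟩

lemma star_def (x : WeylStar d) : star x = starHom x := rfl

lemma star_mono (z : E d × E d) (c : ℂ) :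
    star (mono z c) = mono (-z) (star c * phase (-(inner ℝ z.1 z.2))) := by
  rw [star_def]
  change (Finsupp.liftAddHom _) (Finsupp.single z c) = _
  rw [Finsupp.liftAddHom_apply_single]
  rfl

instance : StarRing (WeylStar d) where
  star_involutive x := by
    induction x using induction_mono with
    | h0 => simp only [star_def, map_zero]
    | hadd x y hx hy => simp only [star_def, map_add] at hx hy ⊢; rw [hx, hy]
    | hm z c =>
      simp only [star_mono, neg_neg, star_mul', star_star, star_phase, Prod.fst_neg, Prod.snd_neg,
        inner_neg_left, inner_neg_right]
      rw [mul_assoc, ← phase_add]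
      simp [phase_zero]
  star_mul x y := by
    induction x using induction_mono with
    | h0 => simp only [star_def, map_zero, zero_mul, mul_zero]
    | hadd x x' h h' =>
      simp only [star_def, map_add, add_mul, mul_add] at h h' ⊢
      rw [h, h']
    | hm p a =>
      induction y using induction_mono with
      | h0 => simp only [star_def, map_zero, zero_mul, mul_zero]
      | hadd x x' h h' =>
        simp only [star_def, map_add, add_mul, mul_add] at h h' ⊢
        rw [h, h']
      | hm q b =>
        simp only [star_mono, mono_mul_mono, star_mul', star_phase, Prod.fst_add, Prod.snd_add,
          Prod.fst_neg, Prod.snd_neg, inner_neg_left, inner_neg_right, inner_add_left,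
          inner_add_right, neg_neg, neg_add, phase_add]
        rw [add_comm (-p)]
        congr 1
        have h : phase (inner ℝ q.1 p.2) * phase (-(inner ℝ q.1 p.2)) = 1 := by
          rw [← phase_add, add_neg_cancel, phase_zero]
        linear_combination (star a * star b * phase (-(inner ℝ p.1 p.2)) *
          phase (-(inner ℝ p.1 q.2)) * phase (-(inner ℝ q.1 q.2))) * h
  star_add x y := map_add starHom x y

instance : StarModule ℂ (WeylStar d) where
  star_smul r x := by
    induction x using induction_mono with
    | h0 => simp only [star_def, map_zero, smul_zero]
    | hadd x y hx hy => simp only [star_def, map_add, smul_add] at hx hy ⊢; rw [hx, hy]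
    | hm z c => simp only [smul_mono, star_mono, star_mul', mul_assoc]

/-- A representation of the Weyl star-algebra by bounded operators on a complex Hilbert space. -/
structure Rep (d : ℕ) : Type 1 where
  H : Type
  [normed : NormedAddCommGroup H]
  [inner : InnerProductSpace ℂ H]
  [complete : CompleteSpace H]
  hom : WeylStar d →⋆ₐ[ℂ] (H →L[ℂ] H)

attribute [instance] Rep.normed Rep.inner Rep.complete

/-- The trivial representation on the zero space. -/
instance : Nonempty (Rep d) :=
  ⟨{ H := EuclideanSpace ℂ (Fin 0)
     hom :=
      { toFun := fun _ => 0
        map_one' := by ext x i; exact i.elim0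
        map_mul' := by simp
        map_zero' := rfl
        map_add' := by simp
        commutes' := fun r => by ext x i; exact i.elim0
        map_star' := by simp } }⟩

/-- The norm of the Weyl star-algebra: the supremum of `‖ρ(a)‖` over all representations `ρ`. -/
instance : Norm (WeylStar d) := ⟨fun a => ⨆ ρ : Rep d, ‖ρ.hom a‖⟩

lemma norm_def (a : WeylStar d) : ‖a‖ = ⨆ ρ : Rep d, ‖ρ.hom a‖ := rfl

lemma star_mono_mul_mono (z : E d × E d) : star (mono z 1) * mono z 1 = 1 := by
  rw [star_mono, mono_mul_mono, one_def]
  simp only [star_one, one_mul, mul_one, Prod.snd_neg, inner_neg_right, neg_neg, ← phase_add,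
    neg_add_cancel, phase_zero]

lemma mono_mul_star_mono (z : E d × E d) : mono z 1 * star (mono z 1) = 1 := by
  rw [star_mono, mono_mul_mono, one_def]
  simp only [star_one, one_mul, Prod.fst_neg, inner_neg_left, neg_neg, ← phase_add,
    neg_add_cancel, phase_zero, add_neg_cancel]

lemma norm_rep_mono_le (ρ : Rep d) (z : E d × E d) : ‖ρ.hom (mono z 1)‖ ≤ 1 := by
  have h : star (ρ.hom (mono z 1)) * ρ.hom (mono z 1) = 1 := by
    rw [← map_star, ← map_mul, star_mono_mul_mono, map_one]
  have h1 : ‖ρ.hom (mono z 1)‖ * ‖ρ.hom (mono z 1)‖ ≤ 1 := by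
    rw [← CStarRing.norm_star_mul_self, h]
    exact ContinuousLinearMap.norm_id_le
  nlinarith [norm_nonneg (ρ.hom (mono z 1))]

lemma bddAbove_norm_rep (a : WeylStar d) : BddAbove (Set.range fun ρ : Rep d => ‖ρ.hom a‖) := by
  induction a using induction_mono with
  | h0 => exact ⟨0, by rintro _ ⟨ρ, rfl⟩; simp⟩
  | hadd x y hx hy =>
    obtain ⟨A, hA⟩ := hx
    obtain ⟨B, hB⟩ := hy
    refine ⟨A + B, ?_⟩
    rintro _ ⟨ρ, rfl⟩
    simp only [map_add]
    exact (norm_add_le _ _).trans (add_le_add (hA ⟨ρ, rfl⟩) (hB ⟨ρ, rfl⟩))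
  | hm z c =>
    refine ⟨‖c‖, ?_⟩
    rintro _ ⟨ρ, rfl⟩
    have : mono z c = c • mono z 1 := by rw [smul_mono, mul_one]
    simp only [this, map_smul, norm_smul]
    exact mul_le_of_le_one_right (norm_nonneg c) (norm_rep_mono_le ρ z)

lemma norm_rep_le (ρ : Rep d) (a : WeylStar d) : ‖ρ.hom a‖ ≤ ‖a‖ :=
  le_ciSup (bddAbove_norm_rep a) ρ

instance : SeminormedAddCommGroup (WeylStar d) :=
  AddGroupSeminorm.toSeminormedAddCommGroup
    { toFun := fun a => ‖a‖
      map_zero' := by simp [norm_def]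
      add_le' := fun x y => ciSup_le fun ρ => by
        rw [map_add]
        exact (norm_add_le _ _).trans (add_le_add (norm_rep_le ρ x) (norm_rep_le ρ y))
      neg' := fun x => by simp [norm_def] }

instance : SeminormedRing (WeylStar d) where
  dist_eq _ _ := rfl
  norm_mul_le x y := ciSup_le fun ρ => by
    rw [map_mul]
    exact (norm_mul_le _ _).trans
      (mul_le_mul (norm_rep_le ρ x) (norm_rep_le ρ y) (norm_nonneg _)
        ((norm_nonneg _).trans (norm_rep_le ρ x)))

instance : NormedAlgebra ℂ (WeylStar d) where
  norm_smul_le r x := ciSup_le fun ρ => by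
    rw [map_smul, norm_smul]
    exact mul_le_mul_of_nonneg_left (norm_rep_le ρ x) (norm_nonneg r)

lemma norm_star_eq (x : WeylStar d) : ‖star x‖ = ‖x‖ := by
  simp only [norm_def, map_star, norm_star]

lemma norm_mul_self_le_star (x : WeylStar d) : ‖x‖ * ‖x‖ ≤ ‖star x * x‖ := by
  have h : ‖x‖ ≤ Real.sqrt ‖star x * x‖ := ciSup_le fun ρ => by
    apply Real.le_sqrt_of_sq_le
    rw [sq, ← CStarRing.norm_star_mul_self, ← map_star, ← map_mul]
    exact norm_rep_le ρ _
  calc ‖x‖ * ‖x‖ ≤ Real.sqrt ‖star x * x‖ * Real.sqrt ‖star x * x‖ :=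
        mul_self_le_mul_self (norm_nonneg x) h
    _ = ‖star x * x‖ := Real.mul_self_sqrt (norm_nonneg _)

lemma isometry_star : Isometry (star : WeylStar d → WeylStar d) :=
  AddMonoidHomClass.isometry_of_norm (starHom (d := d)) norm_star_eq

end WeylStar

/-! ### The Weyl C⋆-algebra -/

open UniformSpace in
/-- The Weyl C⋆-algebra: the completion of the Weyl star-algebra. -/
def Weyl (d : ℕ) : Type := Completion (WeylStar d)

namespace Weyl

variable {d : ℕ}

open UniformSpace

instance : NormedRing (Weyl d) := inferInstanceAs (NormedRing (Completion (WeylStar d)))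

instance : CompleteSpace (Weyl d) := inferInstanceAs (CompleteSpace (Completion (WeylStar d)))

instance : Module ℂ (Weyl d) := inferInstanceAs (Module ℂ (Completion (WeylStar d)))

/-- The canonical map from the Weyl star-algebra to its completion. -/
def of (a : WeylStar d) : Weyl d := (a : Completion (WeylStar d))

lemma continuous_of : Continuous (of : WeylStar d → Weyl d) := Completion.continuous_coe _

lemma of_mul (a b : WeylStar d) : of (a * b) = of a * of b := Completion.coe_mul a b

lemma of_add (a b : WeylStar d) : of (a + b) = of a + of b := Completion.coe_add a b

lemma of_one : of (1 : WeylStar d) = 1 := rfl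

lemma of_smul (r : ℂ) (a : WeylStar d) : of (r • a) = r • of a := Completion.coe_smul r a

lemma norm_of (a : WeylStar d) : ‖of a‖ = ‖a‖ := Completion.norm_coe a

lemma induction_of {p : Weyl d → Prop} (x : Weyl d) (hp : IsClosed {x | p x})
    (h : ∀ a, p (of a)) : p x :=
  Completion.induction_on x hp h

lemma continuous_smul_left (r : ℂ) : Continuous fun x : Weyl d => r • x :=
  Completion.continuous_map

instance : Algebra ℂ (Weyl d) :=
  Algebra.ofModule
    (fun r x y => by
      induction x using induction_of with
      | hp =>
        exact isClosed_eq ((continuous_smul_left r).mul continuous_const)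
          ((continuous_smul_left r).comp (continuous_id.mul continuous_const))
      | h a =>
        induction y using induction_of with
        | hp =>
          exact isClosed_eq (continuous_const.mul continuous_id)
            ((continuous_smul_left r).comp (continuous_const.mul continuous_id))
        | h b => rw [← of_smul, ← of_mul, ← of_mul, ← of_smul, smul_mul_assoc])
    (fun r x y => by
      induction x using induction_of with
      | hp =>
        exact isClosed_eq (continuous_id.mul continuous_const)
          ((continuous_smul_left r).comp (continuous_id.mul continuous_const))
      | h a =>
        induction y using induction_of with
        | hp =>
          exact isClosed_eq (continuous_const.mul (continuous_smul_left r))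
            ((continuous_smul_left r).comp (continuous_const.mul continuous_id))
        | h b => rw [← of_smul, ← of_mul, ← of_mul, ← of_smul, mul_smul_comm])

instance : NormedAlgebra ℂ (Weyl d) where
  norm_smul_le r x := norm_smul_le (β := Completion (WeylStar d)) r x

instance : Star (Weyl d) := ⟨Completion.map (star : WeylStar d → WeylStar d)⟩

lemma continuous_star' : Continuous (star : Weyl d → Weyl d) := Completion.continuous_map

lemma of_star (a : WeylStar d) : of (star a) = star (of a) :=
  (Completion.map_coe WeylStar.isometry_star.uniformContinuous a).symm

instance : StarRing (Weyl d) where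
  star_involutive x := by
    induction x using induction_of with
    | hp => exact isClosed_eq (continuous_star'.comp continuous_star') continuous_id
    | h a => rw [← of_star, ← of_star, star_star]
  star_mul x y := by
    induction x using induction_of with
    | hp =>
      exact isClosed_eq (continuous_star'.comp (by fun_prop))
        (continuous_const.mul continuous_star')
    | h a =>
      induction y using induction_of with
      | hp =>
        exact isClosed_eq (continuous_star'.comp (by fun_prop))
          (continuous_star'.mul continuous_const)
      | h b => rw [← of_mul, ← of_star, star_mul, of_mul, of_star, of_star]
  star_add x y := by
    induction x using induction_of with
    | hp =>
      exact isClosed_eq (continuous_star'.comp (by fun_prop))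
        (continuous_star'.add continuous_const)
    | h a =>
      induction y using induction_of with
      | hp =>
        exact isClosed_eq (continuous_star'.comp (by fun_prop))
          (continuous_const.add continuous_star')
      | h b => rw [← of_add, ← of_star, star_add, of_add, of_star, of_star]

instance : StarModule ℂ (Weyl d) where
  star_smul r x := by
    induction x using induction_of with
    | hp =>
      exact isClosed_eq (continuous_star'.comp (continuous_smul_left r))
        ((continuous_smul_left (star r)).comp continuous_star')
    | h a => rw [← of_smul, ← of_star, star_smul, of_smul, of_star]

instance : CStarRing (Weyl d) where
  norm_mul_self_le x := by
    induction x using induction_of with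
    | hp =>
      exact isClosed_le (by fun_prop) (continuous_norm.comp (continuous_star'.mul continuous_id))
    | h a => rw [← of_star, ← of_mul, norm_of, norm_of]; exact WeylStar.norm_mul_self_le_star a

instance : CStarAlgebra (Weyl d) where

lemma of_mono_mem_unitary (z : E d × E d) : of (WeylStar.mono z 1) ∈ unitary (Weyl d) := by
  rw [Unitary.mem_iff, ← of_star, ← of_mul, ← of_mul, WeylStar.star_mono_mul_mono,
    WeylStar.mono_mul_star_mono, of_one]
  exact ⟨rfl, rfl⟩

/-- The unitary generators `u_α`. -/
def u (α : E d) : unitary (Weyl d) := ⟨of (WeylStar.mono (α, 0) 1), of_mono_mem_unitary _⟩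

/-- The unitary generators `v_β`. -/
def v (β : E d) : unitary (Weyl d) := ⟨of (WeylStar.mono (0, β) 1), of_mono_mem_unitary _⟩

/-- The Weyl relation. -/
lemma u_mul_v (α β : E d) :
    (u α : Weyl d) * (v β : Weyl d) = phase (inner ℝ α β) • ((v β : Weyl d) * (u α : Weyl d)) := by
  simp only [u, v, ← of_mul, ← of_smul, WeylStar.mono_mul_mono, WeylStar.smul_mono]
  simp [← phase_add, phase_zero]

lemma u_add (α α' : E d) : u (α + α') = u α * u α' := by
  ext
  simp [u, ← of_mul, WeylStar.mono_mul_mono, phase_zero]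

lemma v_add (β β' : E d) : v (β + β') = v β * v β' := by
  ext
  simp [v, ← of_mul, WeylStar.mono_mul_mono, phase_zero]

lemma star_u (α : E d) : star (u α) = u (-α) := by
  ext
  simp [u, ← of_star, WeylStar.star_mono, phase_zero]

lemma star_v (β : E d) : star (v β) = v (-β) := by
  ext
  simp [v, ← of_star, WeylStar.star_mono, phase_zero]

/-- The space translations `τ_l(a) = v_l a v_l^*`. -/
def τ (l : E d) : Weyl d ≃⋆ₐ[ℂ] Weyl d := Unitary.conjStarAlgAut ℂ (Weyl d) (v l)

/-- The momentum translations `θ_α(a) = u_α a u_α^*`. -/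
def θ (α : E d) : Weyl d ≃⋆ₐ[ℂ] Weyl d := Unitary.conjStarAlgAut ℂ (Weyl d) (u α)

end Weyl

/-! ### States of a unital C⋆-algebra -/

section States

variable {A : Type*} [CStarAlgebra A]

variable (A) in
/-- The states of `A`: positive normalized linear functionals, with the topology of pointwise
convergence. (Positive functionals on a C⋆-algebra are automatically continuous.) -/
def states : Set (WeakDual ℂ A) := {ω | ω 1 = 1 ∧ ∀ a : A, 0 ≤ ω (star a * a)}

variable (A) in
/-- The pure states of `A`: states that are not proper convex combinations of two states. -/
def pureStates : Set (WeakDual ℂ A) := (states A).extremePoints ℝ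

/-- The functional `ω ∘ f`, for a star-automorphism `f`. -/
def pullback (ω : WeakDual ℂ A) (f : A ≃⋆ₐ[ℂ] A) : WeakDual ℂ A :=
  ContinuousLinearMap.comp (WeakDual.toStrongDual ω)
    ⟨(f.toAlgEquiv.toLinearEquiv : A →ₗ[ℂ] A), (StarAlgEquiv.isometry f).continuous⟩

lemma pullback_apply (ω : WeakDual ℂ A) (f : A ≃⋆ₐ[ℂ] A) (a : A) : pullback ω f a = ω (f a) := rfl

/-- The path `t ↦ f t` of star-automorphisms of `A` implements an automorphic equivalence inside `K`
between `ω₀` and `ω₁`: it is strongly continuous, and `t ↦ ω₀ ∘ f t` is a weak-star continuous path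
in `K` that joins `ω₀` and `ω₁`. -/
structure ImplementsEquivalence (K : Set (WeakDual ℂ A)) (ω₀ ω₁ : WeakDual ℂ A)
    (f : unitInterval → A ≃⋆ₐ[ℂ] A) : Prop where
  strongly_continuous : ∀ a : A, Continuous fun t => f t a
  mem : ∀ t, pullback ω₀ (f t) ∈ K
  continuous : Continuous fun t => pullback ω₀ (f t)
  source : pullback ω₀ (f 0) = ω₀
  target : pullback ω₀ (f 1) = ω₁

/-- Automorphic equivalence of two elements of `K`, inside `K`. -/
def AutomorphicallyEquivalent (K : Set (WeakDual ℂ A)) (ω₀ ω₁ : WeakDual ℂ A) : Prop :=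
  ω₀ ∈ K ∧ ω₁ ∈ K ∧ ∃ f : unitInterval → A ≃⋆ₐ[ℂ] A, ImplementsEquivalence K ω₀ ω₁ f

end States

/-! ### Plane-wave states -/

/-- The states of the Weyl algebra that are invariant under all space translations. -/
def translationInvariantStates (d : ℕ) : Set (WeakDual ℂ (Weyl d)) :=
  {ω | ω ∈ states (Weyl d) ∧ ∀ l : E d, pullback ω (Weyl.τ l) = ω}

/-- Semi-regularity in the parameter `β`: the maps `s ↦ ω(u_α v_(sβ))` on `ℝ` are continuous. -/
def SemiRegular {d : ℕ} (ω : WeakDual ℂ (Weyl d)) : Prop :=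
  ∀ α β : E d, Continuous fun s : ℝ => ω ((Weyl.u α : Weyl d) * (Weyl.v (s • β) : Weyl d))

/-- The plane-wave states: pure, translation-invariant and semi-regular in `β`. -/
def planeWaveStates (d : ℕ) : Set (WeakDual ℂ (Weyl d)) :=
  {ω | ω ∈ translationInvariantStates d ∧ ω ∈ pureStates (Weyl d) ∧ SemiRegular ω}

open scoped Classical in
/-- `ω` is the momentum-`p` functional: `ω(u_α v_β) = δ_(α,0) exp(-i p·β)`. As the `u_α v_β` span a
dense subspace, there is at most one such `ω`. -/
def HasMomentum {d : ℕ} (ω : WeakDual ℂ (Weyl d)) (p : E d) : Prop :=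
  ∀ α β : E d, ω ((Weyl.u α : Weyl d) * (Weyl.v β : Weyl d)) =
    if α = 0 then phase (-(inner ℝ p β)) else 0

end WeylCCR

end

/-! The monomials u_α v_β span a dense subspace and are eigenvectors of all translations: τ_l
multiplies u_α v_β by exp(-i α·l), θ_γ by exp(i γ·β). Hence a τ-invariant state vanishes on the
monomials with α ≠ 0 (`apply_monomial_eq_zero`) and is determined by the function β ↦ ω(v_β).

Purity makes this function a character (`apply_v_add`). For a phase z, the compressions of ω by 1 +
z v_γ and 1 - z v_γ are positive and, by translation invariance, add up to 4ω. A positive functional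
dominated by a pure state is a multiple of it (`eq_smul_of_mem_pureStates`), and evaluation at v_β
for z = 1 and z = i gives ω(v_(β+γ)) = ω(v_β) ω(v_γ). States are contractive on unitaries, so the
character is unitary, and semi-regularity makes it exp(-i p·β) (`exists_eq_phase_inner`).

Conversely, ω_p is the vector state of the basis vector e_p in the representation on ℓ²(ℝ^d) where
u_α shifts the momentum by α and v_β multiplies by exp(-i k·β). It is pure because |ω_p(v_β)| = 1:
both parts of a convex decomposition agree with ω_p on every v_β, and the Weyl relation then makes
them vanish on u_α v_β for α ≠ 0 (`hasMomentum_of_apply_v`).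

Finally ω_p ∘ θ_γ = ω_(p-γ), so θ_(tp) leads from ω_p through the plane waves ω_((1-t)p) to ω_0.
Strong continuity is clear on monomials and passes to limits because automorphisms are isometric. -/

noncomputable section

namespace WeylCCR

open scoped ComplexOrder

/-! ### Positive functionals and pure states -/

section PositiveFunctionals

variable {A : Type*} [CStarAlgebra A]

/-- Positivity of a continuous functional on a C⋆-algebra. -/
def IsPositive (φ : WeakDual ℂ A) : Prop := ∀ a : A, 0 ≤ φ (star a * a)

/-- Polarization: the imaginary part of φ(x⋆x) vanishes for x = a + b and x = a + i b, which gives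
the imaginary and the real part of the identity. -/
lemma IsPositive.conj_apply_star_mul {φ : WeakDual ℂ A} (h : IsPositive φ) (a b : A) :
    star (φ (star b * a)) = φ (star a * b) := by
  have key : ∀ x : A, (φ (star x * x)).im = 0 := fun x => ((Complex.nonneg_iff.1 (h x)).2).symm
  have h1 := key (a + b)
  have h2 := key (a + Complex.I • b)
  have ha := key a
  have hb := key b
  simp only [star_add, star_smul, mul_add, add_mul, smul_mul_assoc, mul_smul_comm, map_add,
    map_smul, smul_eq_mul, Complex.add_im, Complex.mul_im, Complex.mul_re, Complex.star_def,
    Complex.conj_I, Complex.neg_re, Complex.neg_im, Complex.I_re, Complex.I_im] at h1 h2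
  apply Complex.ext
  · simp only [Complex.star_def, Complex.conj_re]
    linarith
  · simp only [Complex.star_def, Complex.conj_im]
    linarith

/-- The positive semidefinite sesquilinear form of a positive functional. -/
abbrev IsPositive.core {φ : WeakDual ℂ A} (h : IsPositive φ) : PreInnerProductSpace.Core ℂ A where
  inner a b := φ (star a * b)
  conj_inner_symm a b := h.conj_apply_star_mul a b
  re_inner_nonneg a := (Complex.nonneg_iff.1 (h a)).1
  add_left a b c := by rw [star_add, add_mul, map_add]
  smul_left a b r := by rw [star_smul, smul_mul_assoc, map_smul, smul_eq_mul]; rfl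

/-- Cauchy–Schwarz for the semidefinite form of φ: null vectors lie in its radical. -/
lemma IsPositive.apply_star_mul_eq_zero {φ : WeakDual ℂ A} (h : IsPositive φ) {b : A}
    (hb : φ (star b * b) = 0) (a : A) : φ (star a * b) = 0 := by
  have cs := @InnerProductSpace.Core.inner_mul_inner_self_le ℂ A _ _ _ h.core a b
  change ‖φ (star a * b)‖ * ‖φ (star b * a)‖ ≤ (φ (star a * a)).re * (φ (star b * b)).re at cs
  rw [hb, ← h.conj_apply_star_mul b a, norm_star, Complex.zero_re, mul_zero] at cs
  rw [← norm_eq_zero, ← mul_self_eq_zero]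
  exact le_antisymm cs (mul_self_nonneg _)

lemma IsPositive.apply_mul_eq_zero {φ : WeakDual ℂ A} (h : IsPositive φ) {b : A}
    (hb : φ (star b * b) = 0) (a : A) : φ (a * b) = 0 := by
  simpa using h.apply_star_mul_eq_zero hb (star a)

lemma IsPositive.eq_zero {φ : WeakDual ℂ A} (h : IsPositive φ) (h1 : φ 1 = 0) (a : A) :
    φ a = 0 := by
  simpa using h.apply_mul_eq_zero (b := 1) (by simpa using h1) a

lemma IsPositive.apply_one {φ : WeakDual ℂ A} (h : IsPositive φ) :
    0 ≤ (φ 1).re ∧ φ 1 = (φ 1).re := by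
  have h1 := h 1
  rw [star_one, mul_one, Complex.nonneg_iff] at h1
  exact ⟨h1.1, Complex.ext rfl h1.2.symm⟩

lemma IsPositive.normalize_mem_states {φ : WeakDual ℂ A} (h : IsPositive φ)
    (h1 : (φ 1).re ≠ 0) : ((φ 1).re)⁻¹ • φ ∈ states A := by
  have h0 := h.apply_one
  refine ⟨?_, fun a => ?_⟩
  · change ((φ 1).re)⁻¹ • φ 1 = 1
    rw [h0.2, Complex.ofReal_re, Complex.real_smul, ← Complex.ofReal_mul, inv_mul_cancel₀ h1,
      Complex.ofReal_one]
  · exact smul_nonneg (inv_nonneg.2 h0.1) (h a)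

/-- A positive functional dominated by a pure state is a multiple of it. -/
lemma eq_smul_of_mem_pureStates {ω φ ψ : WeakDual ℂ A} (hω : ω ∈ pureStates A)
    (hφ : IsPositive φ) (hψ : IsPositive ψ) (hsum : ∀ a, φ a + ψ a = ω a) (a : A) :
    φ a = φ 1 * ω a := by
  have e1 := hsum 1
  rw [hω.1.1] at e1
  have er : (φ 1).re + (ψ 1).re = 1 := by simpa using congrArg Complex.re e1
  -- A summand of mass zero cannot be normalized to a state, but it vanishes identically, so these
  -- two cases are settled directly.
  by_cases h0 : (φ 1).re = 0
  · have : φ 1 = 0 := by rw [hφ.apply_one.2, h0, Complex.ofReal_zero]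
    rw [hφ.eq_zero this, this, zero_mul]
  by_cases h1 : (ψ 1).re = 0
  · have : ψ 1 = 0 := by rw [hψ.apply_one.2, h1, Complex.ofReal_zero]
    have h2 := hsum a
    rw [this, add_zero] at e1
    rw [hψ.eq_zero this, add_zero] at h2
    rw [e1, h2, one_mul]
  have key := (mem_extremePoints.1 hω).2 _ (hφ.normalize_mem_states h0) _
    (hψ.normalize_mem_states h1)
    ⟨(φ 1).re, (ψ 1).re, lt_of_le_of_ne hφ.apply_one.1 (Ne.symm h0),
      lt_of_le_of_ne hψ.apply_one.1 (Ne.symm h1), er, by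
        refine DFunLike.ext _ _ fun x => ?_
        change (φ 1).re • ((φ 1).re)⁻¹ • φ x + (ψ 1).re • ((ψ 1).re)⁻¹ • ψ x = ω x
        rw [smul_inv_smul₀ h0, smul_inv_smul₀ h1, hsum]⟩
  have h2 : ((φ 1).re)⁻¹ • φ a = ω a := DFunLike.congr_fun key.1 a
  rw [← h2, hφ.apply_one.2, Complex.ofReal_re, Complex.real_smul, Complex.ofReal_inv,
    mul_inv_cancel_left₀ (by exact_mod_cast h0)]

/-- The functional `a ↦ φ (c⋆ a c)`. -/
def compress (φ : WeakDual ℂ A) (c : A) : WeakDual ℂ A :=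
  (WeakDual.toStrongDual φ).comp
    ((ContinuousLinearMap.mul ℂ A (star c)).comp ((ContinuousLinearMap.mul ℂ A).flip c))

lemma compress_apply (φ : WeakDual ℂ A) (c a : A) : compress φ c a = φ (star c * (a * c)) := rfl

lemma IsPositive.compress {φ : WeakDual ℂ A} (h : IsPositive φ) (c : A) :
    IsPositive (compress φ c) := fun a => by
  have := h (a * c)
  rwa [star_mul, mul_assoc, ← mul_assoc (star a) a c] at this

/-- Cauchy–Schwarz between 1 and w, both of which have length one in the form of φ. -/
lemma norm_apply_unitary_le_one {φ : WeakDual ℂ A} (h : φ ∈ states A) (w : unitary A) :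
    ‖φ (w : A)‖ ≤ 1 := by
  have cs := @InnerProductSpace.Core.inner_mul_inner_self_le ℂ A _ _ _
    (IsPositive.core (φ := φ) h.2) 1 (w : A)
  change ‖φ (star 1 * (w : A))‖ * ‖φ (star (w : A) * 1)‖ ≤
    (φ (star 1 * 1)).re * (φ (star (w : A) * (w : A))).re at cs
  rw [← IsPositive.conj_apply_star_mul h.2 (w : A) 1, norm_star, Unitary.coe_star_mul_self,
    star_one, one_mul, one_mul, h.1, Complex.one_re, mul_one] at cs
  nlinarith [norm_nonneg (φ (w : A))]

/-- A state whose value at a unitary `w` is a phase `c` does not distinguish `w` from `c`. -/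
lemma apply_mul_unitary {φ : WeakDual ℂ A} (h : φ ∈ states A) (w : unitary A)
    (hc : ‖φ (w : A)‖ = 1) (a : A) :
    φ (a * (w : A)) = φ (w : A) * φ a ∧ φ ((w : A) * a) = φ (w : A) * φ a := by
  have hp : IsPositive φ := h.2
  have hcc : star (φ (w : A)) * φ (w : A) = 1 := by
    rw [Complex.star_def, ← Complex.normSq_eq_conj_mul_self, Complex.normSq_eq_norm_sq, hc]; simp
  have hstar : φ (star (w : A)) = star (φ (w : A)) := by
    have := hp.conj_apply_star_mul (w : A) 1
    rw [star_one, one_mul, mul_one] at this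
    exact this.symm
  -- Stated for an arbitrary unitary so that it also applies to w⋆ and a⋆; adjoints then turn that
  -- instance into the identity for left multiplication by w.
  have right : ∀ (w : unitary A), star (φ (w : A)) * φ (w : A) = 1 →
      φ (star (w : A)) = star (φ (w : A)) → ∀ a, φ (a * (w : A)) = φ (w : A) * φ a := by
    intro w hcc hstar a
    -- With c = φ(w), this value is 1 - |c|² = 0. In GNS terms, the cyclic vector is an eigenvector
    -- of w with eigenvalue c.
    have h0 : φ (star ((w : A) - φ (w : A) • 1) * ((w : A) - φ (w : A) • 1)) = 0 := by
      simp only [star_sub, star_smul, star_one, sub_mul, mul_sub, smul_mul_assoc, mul_smul_comm,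
        one_mul, mul_one, Unitary.coe_star_mul_self, map_sub, map_smul, smul_eq_mul, h.1, hstar]
      linear_combination -hcc
    have := hp.apply_mul_eq_zero h0 a
    rwa [mul_sub, map_sub, mul_smul_comm, mul_one, map_smul, smul_eq_mul, sub_eq_zero] at this
  refine ⟨right w hcc hstar a, ?_⟩
  have h2 := right (star w) (by rw [Unitary.coe_star, hstar, star_star, mul_comm, hcc])
    (by rw [Unitary.coe_star, star_star, hstar, star_star]) (star a)
  rw [Unitary.coe_star, ← star_mul, hstar] at h2
  have conj : ∀ x, φ (star x) = star (φ x) := fun x => by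
    have := hp.conj_apply_star_mul x 1
    rw [star_one, one_mul, mul_one] at this
    exact this.symm
  rw [conj, conj, ← star_mul'] at h2
  exact star_injective h2

end PositiveFunctionals

/-! ### Continuous characters of the real line -/

lemma norm_phase (x : ℝ) : ‖phase x‖ = 1 := by
  rw [phase, mul_comm, Complex.norm_exp_ofReal_mul_I]

open intervalIntegral in
/-- A continuous unitary character of the real line is `s ↦ exp(i c s)` for some real `c`. -/
lemma exists_eq_phase {f : ℝ → ℂ} (hf : Continuous f) (hadd : ∀ s t, f (s + t) = f s * f t)
    (hnorm : ∀ s, ‖f s‖ = 1) : ∃ c : ℝ, ∀ s, f s = phase (c * s) := by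
  have f0 : f 0 = 1 := by
    have h := hadd 0 0
    rw [add_zero] at h
    exact (mul_eq_left₀ (by rw [← norm_ne_zero_iff, hnorm]; exact one_ne_zero)).1 h.symm
  have hder : ∀ a x, HasDerivAt (fun u => ∫ t in a..u, f t) (f x) x :=
    fun a x => (hf.integral_hasStrictDerivAt a x).hasDerivAt
  -- The primitive of f has derivative f(0) = 1 at 0, so it is not identically zero.
  obtain ⟨h, hA⟩ : ∃ h, (∫ t in (0 : ℝ)..h, f t) ≠ 0 := by
    by_contra! H
    have h1 := hder 0 0
    simp only [H, f0] at h1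
    exact one_ne_zero (h1.unique (hasDerivAt_const 0 (0 : ℂ)))
  set I : ℂ := ∫ t in (0 : ℝ)..h, f t with hI
  -- Integrating f(s + t) = f(s) f(t) over t from 0 to h expresses f by its primitive, so continuity
  -- upgrades to differentiability.
  have hs : ∀ s, f s = ((∫ t in (0 : ℝ)..s + h, f t) - ∫ t in (0 : ℝ)..s, f t) / I := by
    intro s
    rw [integral_interval_sub_left (hf.intervalIntegrable _ _) (hf.intervalIntegrable _ _),
      eq_div_iff hA, hI, ← integral_const_mul]
    have := integral_comp_add_left (a := 0) (b := h) f s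
    rw [add_zero] at this
    rw [← this]
    exact integral_congr fun t _ => (hadd s t).symm
  -- Differentiating that formula yields the equation f' = k f with k = (f(h) - 1) / I.
  have hd : ∀ s, HasDerivAt f ((f h - 1) / I * f s) s := by
    intro s
    have h1 := (((hder 0 (s + h)).comp_add_const s h).sub (hder 0 s)).div_const I
    rw [show (f h - 1) / I * f s = (f (s + h) - f s) / I by rw [hadd]; ring]
    refine h1.congr_of_eventuallyEq (Filter.Eventually.of_forall fun x => ?_)
    exact hs x
  set k : ℂ := (f h - 1) / I
  have hexp : ∀ s : ℝ, f s = Complex.exp (k * s) := by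
    have hc : ∀ s : ℝ, HasDerivAt (fun s : ℝ => f s * Complex.exp (-(k * s))) 0 s := by
      intro s
      have e1 : HasDerivAt (fun s : ℝ => -(k * (s : ℂ))) (-(k * 1)) s :=
        ((Complex.ofRealCLM.hasDerivAt (x := s)).const_mul k).neg
      refine ((hd s).mul e1.cexp).congr_deriv ?_
      ring
    intro s
    have := is_const_of_deriv_eq_zero (fun s => (hc s).differentiableAt) (fun s => (hc s).deriv) s 0
    simp only [f0, Complex.ofReal_zero, mul_zero, neg_zero, Complex.exp_zero, mul_one] at this
    rw [Complex.exp_neg, mul_inv_eq_one₀ (Complex.exp_ne_zero _)] at this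
    exact this
  have hre : k.re = 0 := by
    have h1 := hnorm 1
    rw [hexp, Complex.norm_exp, Real.exp_eq_one_iff] at h1
    simpa using h1
  refine ⟨k.im, fun s => ?_⟩
  rw [hexp, phase]
  congr 1
  apply Complex.ext <;> simp [hre]

/-- A character of `ℝ^d` that is continuous on lines is `x ↦ exp(-i p·x)` for some `p`. -/
lemma exists_eq_phase_inner {d : ℕ} {f : E d → ℂ} (hf : ∀ x, Continuous fun s : ℝ => f (s • x))
    (hadd : ∀ x y, f (x + y) = f x * f y) (hnorm : ∀ x, ‖f x‖ = 1) :
    ∃ p : E d, ∀ x, f x = phase (-(inner ℝ p x)) := by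
  let b := EuclideanSpace.basisFun (Fin d) ℝ
  have h := fun i => exists_eq_phase (hf (b i))
    (fun s t => by rw [add_smul, hadd]) (fun s => hnorm _)
  choose c hc using h
  have f0 : f 0 = 1 := by
    have h := hadd 0 0
    rw [add_zero] at h
    exact (mul_eq_left₀ (by rw [← norm_ne_zero_iff, hnorm]; exact one_ne_zero)).1 h.symm
  have hsum : ∀ (x : E d) (s : Finset (Fin d)),
      f (∑ i ∈ s, x i • b i) = phase (∑ i ∈ s, c i * x i) := by
    intro x s
    induction s using Finset.cons_induction with
    | empty => simp [f0, phase_zero]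
    | cons i s hi ih => rw [Finset.sum_cons, Finset.sum_cons, hadd, ih, phase_add, hc]
  -- The minus sign matches the convention exp(-i p·x) for momentum p.
  refine ⟨WithLp.toLp 2 fun i => -c i, fun x => ?_⟩
  have hx := hsum x Finset.univ
  rw [show ∑ i, x i • b i = x by simpa [b] using b.sum_repr x] at hx
  rw [hx, PiLp.inner_apply, ← Finset.sum_neg_distrib]
  congr 1
  refine Finset.sum_congr rfl fun i _ => ?_
  simp [mul_comm]

/-! ### The representation of the Weyl algebra on `ℓ²(ℝ^d)` -/

section MomentumRepresentation

variable {d : ℕ}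

/-- The Hilbert space `ℓ²(ℝ^d)`, with `ℝ^d` as a discrete set of momenta. -/
abbrev MomentumSpace (d : ℕ) : Type := lp (fun _ : E d => ℂ) 2

/-- The weighted shift `f ↦ (k ↦ exp(-i (k - α)·β) f(k - α))`. -/
def weightedShiftFun (z : E d × E d) (f : E d → ℂ) (k : E d) : ℂ :=
  phase (-(inner ℝ (k - z.1) z.2)) * f (k - z.1)

lemma norm_weightedShiftFun (z : E d × E d) (f : E d → ℂ) (k : E d) :
    ‖weightedShiftFun z f k‖ = ‖f (k - z.1)‖ := by
  rw [weightedShiftFun, norm_mul, norm_phase, one_mul]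

lemma memℓp_weightedShiftFun (z : E d × E d) (f : MomentumSpace d) :
    Memℓp (weightedShiftFun z f) 2 := by
  have h := (memℓp_gen_iff (by simp)).1 (lp.memℓp f)
  rw [memℓp_gen_iff (by simp)]
  simp only [norm_weightedShiftFun]
  exact (Equiv.subRight z.1).summable_iff.2 h

/-- The weighted shifts as linear isometries of `ℓ²(ℝ^d)`. -/
def weightedShift (z : E d × E d) : MomentumSpace d →ₗᵢ[ℂ] MomentumSpace d where
  toFun f := ⟨weightedShiftFun z f, memℓp_weightedShiftFun z f⟩
  map_add' f g := by
    ext k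
    exact mul_add _ (f (k - z.1)) (g (k - z.1))
  map_smul' r f := by
    ext k
    exact mul_left_comm _ r (f (k - z.1))
  norm_map' f := by
    rw [lp.norm_eq_tsum_rpow (by simp), lp.norm_eq_tsum_rpow (by simp)]
    congr 1
    have : ∀ k, ‖weightedShiftFun z f k‖ ^ (2 : ENNReal).toReal =
        (fun k => ‖f k‖ ^ (2 : ENNReal).toReal) (Equiv.subRight z.1 k) := fun k => by
      rw [norm_weightedShiftFun]; rfl
    exact (tsum_congr this).trans ((Equiv.subRight z.1).tsum_eq fun k => ‖f k‖ ^ (2 : ENNReal).toReal)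

lemma weightedShift_apply (z : E d × E d) (f : MomentumSpace d) (k : E d) :
    weightedShift z f k = phase (-(inner ℝ (k - z.1) z.2)) * f (k - z.1) := rfl

lemma weightedShift_zero (f : MomentumSpace d) : weightedShift 0 f = f := by
  ext k
  simp [weightedShift_apply, phase_zero]

/-- The same cocycle as in the product of monomials, which makes the weighted shifts a
representation. -/
lemma weightedShift_weightedShift (z w : E d × E d) (f : MomentumSpace d) :
    weightedShift z (weightedShift w f) =
      phase (-(inner ℝ w.1 z.2)) • weightedShift (z + w) f := by
  ext k
  rw [lp.coeFn_smul, Pi.smul_apply, smul_eq_mul]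
  simp only [weightedShift_apply, Prod.fst_add, Prod.snd_add, ← mul_assoc, ← phase_add,
    sub_add_eq_sub_sub]
  congr 2
  simp only [inner_sub_left, inner_add_right]
  ring

/-- The shift by -z inverts the shift by z up to a phase, so g can be written as a multiple of an
image under the isometry, which then drops out of the inner product. This is compatibility of the
representation with the involution. -/
lemma inner_weightedShift (z : E d × E d) (f g : MomentumSpace d) :
    inner ℂ (weightedShift z f) g =
      phase (-(inner ℝ z.1 z.2)) * inner ℂ f (weightedShift (-z) g) := by
  have h : g = phase (-(inner ℝ z.1 z.2)) • weightedShift z (weightedShift (-z) g) := by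
    rw [weightedShift_weightedShift, add_neg_cancel, weightedShift_zero, smul_smul, ← phase_add]
    simp [phase_zero]
  conv_lhs => rw [h]
  rw [inner_smul_right, LinearIsometry.inner_map_map]

/-- The representation of the Weyl star-algebra on `ℓ²(ℝ^d)` as a linear map. -/
def momentumLinear (d : ℕ) : WeylStar d →ₗ[ℂ] (MomentumSpace d →L[ℂ] MomentumSpace d) :=
  WeylStar.lift fun z => (weightedShift z).toContinuousLinearMap

lemma momentumLinear_mono (z : E d × E d) (c : ℂ) :
    momentumLinear d (WeylStar.mono z c) = c • (weightedShift z).toContinuousLinearMap :=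
  WeylStar.lift_mono _ z c

/-- The representation of the Weyl star-algebra on `ℓ²(ℝ^d)`. -/
def momentumRep (d : ℕ) : WeylStar d →⋆ₐ[ℂ] (MomentumSpace d →L[ℂ] MomentumSpace d) :=
  { AlgHom.ofLinearMap (momentumLinear d)
      (by
        ext1 f
        rw [WeylStar.one_def, momentumLinear_mono, one_smul]
        exact weightedShift_zero f)
      (fun x y => by
        induction x using WeylStar.induction_mono with
        | h0 => simp only [zero_mul, map_zero]
        | hadd x x' h h' => simp only [add_mul, map_add, h, h']
        | hm z a =>
          induction y using WeylStar.induction_mono with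
          | h0 => simp only [mul_zero, map_zero]
          | hadd y y' h h' => simp only [mul_add, map_add, h, h']
          | hm w b =>
            rw [WeylStar.mono_mul_mono, momentumLinear_mono, momentumLinear_mono,
              momentumLinear_mono, smul_mul_smul_comm, mul_smul]
            congr 1
            ext1 f
            exact (weightedShift_weightedShift z w f).symm) with
    map_star' := fun x => by
      change momentumLinear d (star x) = star (momentumLinear d x)
      induction x using WeylStar.induction_mono with
      | h0 => simp only [star_zero, map_zero]
      | hadd x x' h h' => simp only [star_add, map_add, h, h']
      | hm z c =>
        rw [WeylStar.star_mono, momentumLinear_mono, momentumLinear_mono, star_smul, mul_smul]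
        congr 1
        rw [ContinuousLinearMap.star_eq_adjoint, ContinuousLinearMap.eq_adjoint_iff]
        intro f g
        have h := inner_weightedShift z g f
        rw [← inner_conj_symm]
        change _ = inner ℂ f (weightedShift z g)
        rw [← inner_conj_symm f, h]
        congr 1
        exact inner_smul_right _ _ _ }

lemma momentumRep_mono (z : E d × E d) (c : ℂ) :
    momentumRep d (WeylStar.mono z c) = c • (weightedShift z).toContinuousLinearMap :=
  momentumLinear_mono z c

open scoped Classical in
/-- The unit vector of `ℓ²(ℝ^d)` at the momentum `p`. -/
def momentumVector (p : E d) : MomentumSpace d := lp.single 2 p 1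

lemma norm_momentumVector (p : E d) : ‖momentumVector p‖ = 1 := by
  classical
  rw [momentumVector, lp.norm_single (by simp), norm_one]

lemma momentumVector_apply_self (p : E d) : momentumVector p p = 1 :=
  lp.single_apply_self 2 p 1

lemma momentumVector_apply_ne {p k : E d} (h : k ≠ p) : momentumVector p k = 0 :=
  lp.single_apply_ne 2 p 1 h

lemma inner_momentumVector (p : E d) (f : MomentumSpace d) :
    inner ℂ (momentumVector p) f = f p := by
  classical
  rw [momentumVector, lp.inner_single_left]
  simp

end MomentumRepresentation

/-! ### Vector functionals of representations -/

section VectorFunctionals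

variable {d : ℕ} {H : Type} [NormedAddCommGroup H] [InnerProductSpace ℂ H] [CompleteSpace H]

/-- The canonical map into the completion, as a continuous linear map. -/
def ofCLM (d : ℕ) : WeylStar d →L[ℂ] Weyl d where
  toFun := Weyl.of
  map_add' := Weyl.of_add
  map_smul' := Weyl.of_smul
  cont := Weyl.continuous_of

lemma denseRange_ofCLM : DenseRange (ofCLM d) := UniformSpace.Completion.denseRange_coe

lemma isUniformInducing_ofCLM : IsUniformInducing (ofCLM d) :=
  UniformSpace.Completion.isUniformInducing_coe _

/-- The functional `a ↦ ⟪x, ρ(a) x⟫` on the Weyl star-algebra. -/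
def vectorFunctionalStar (ρ : WeylStar d →⋆ₐ[ℂ] (H →L[ℂ] H)) (x : H) : WeylStar d →L[ℂ] ℂ :=
  LinearMap.mkContinuous
    ((innerSL ℂ x).toLinearMap ∘ₗ (ContinuousLinearMap.apply ℂ H x).toLinearMap ∘ₗ
      ρ.toAlgHom.toLinearMap) (‖x‖ * ‖x‖) fun a => by
    calc ‖(inner ℂ x (ρ a x) : ℂ)‖ ≤ ‖x‖ * (‖ρ a‖ * ‖x‖) :=
          (norm_inner_le_norm _ _).trans
            (mul_le_mul_of_nonneg_left ((ρ a).le_opNorm x) (norm_nonneg _))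
      -- The norm of `WeylStar d` is a supremum over representations that include ρ; this bound lets
      -- the functional extend to the completion.
      _ ≤ ‖x‖ * (‖a‖ * ‖x‖) := by gcongr; exact WeylStar.norm_rep_le ⟨H, ρ⟩ a
      _ = ‖x‖ * ‖x‖ * ‖a‖ := by ring

/-- The functional `a ↦ ⟪x, ρ(a) x⟫` on the Weyl C⋆-algebra. -/
def vectorFunctional (ρ : WeylStar d →⋆ₐ[ℂ] (H →L[ℂ] H)) (x : H) : WeakDual ℂ (Weyl d) :=
  StrongDual.toWeakDual ((vectorFunctionalStar ρ x).extend (ofCLM d))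

lemma vectorFunctional_of (ρ : WeylStar d →⋆ₐ[ℂ] (H →L[ℂ] H)) (x : H) (a : WeylStar d) :
    vectorFunctional ρ x (Weyl.of a) = inner ℂ x (ρ a x) :=
  (vectorFunctionalStar ρ x).extend_eq denseRange_ofCLM isUniformInducing_ofCLM a

lemma vectorFunctional_mem_states (ρ : WeylStar d →⋆ₐ[ℂ] (H →L[ℂ] H)) {x : H} (hx : ‖x‖ = 1) :
    vectorFunctional ρ x ∈ states (Weyl d) := by
  refine ⟨?_, fun a => ?_⟩
  · rw [← Weyl.of_one, vectorFunctional_of, map_one, one_apply_eq_self,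
      inner_self_eq_norm_sq_to_K, hx]
    simp
  · induction a using Weyl.induction_of with
    | hp =>
      exact isClosed_le continuous_const
        ((map_continuous (vectorFunctional ρ x)).comp (Weyl.continuous_star'.mul continuous_id))
    | h a =>
      rw [← Weyl.of_star, ← Weyl.of_mul, vectorFunctional_of, map_mul, map_star,
        mul_apply_eq_comp, ContinuousLinearMap.star_eq_adjoint,
        ContinuousLinearMap.adjoint_inner_right, inner_self_eq_norm_sq_to_K]
      exact pow_nonneg (Complex.zero_le_real.2 (norm_nonneg (ρ a x))) 2

end VectorFunctionals

/-! ### Plane-wave states -/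

section PlaneWaves

variable {d : ℕ}

lemma of_mono (z : E d × E d) (c : ℂ) :
    Weyl.of (WeylStar.mono z c) = c • ((Weyl.u z.1 : Weyl d) * (Weyl.v z.2 : Weyl d)) := by
  simp [Weyl.u, Weyl.v, ← Weyl.of_mul, ← Weyl.of_smul, WeylStar.mono_mul_mono,
    WeylStar.smul_mono, phase_zero]

/-- A closed additive property of elements of the Weyl algebra that holds for the multiples of the
monomials holds everywhere. -/
lemma Weyl.induction_mono {P : Weyl d → Prop} (hP : IsClosed {a | P a}) (h0 : P 0)
    (hadd : ∀ a b, P a → P b → P (a + b))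
    (hm : ∀ (α β : E d) (c : ℂ), P (c • ((Weyl.u α : Weyl d) * (Weyl.v β : Weyl d)))) (a : Weyl d) :
    P a := by
  induction a using Weyl.induction_of with
  | hp => exact hP
  | h a =>
    induction a using WeylStar.induction_mono with
    | h0 => exact h0
    | hadd x y hx hy => rw [Weyl.of_add]; exact hadd _ _ hx hy
    | hm z c => rw [of_mono]; exact hm _ _ _

lemma ext_monomials {φ ψ : WeakDual ℂ (Weyl d)}
    (h : ∀ α β : E d, φ ((Weyl.u α : Weyl d) * (Weyl.v β : Weyl d)) =
      ψ ((Weyl.u α : Weyl d) * (Weyl.v β : Weyl d))) : φ = ψ := by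
  refine DFunLike.ext _ _ fun a => ?_
  induction a using Weyl.induction_mono with
  | hP => exact isClosed_eq (map_continuous φ) (map_continuous ψ)
  | h0 => simp only [map_zero]
  | hadd a b ha hb => simp only [map_add, ha, hb]
  | hm α β c => simp only [map_smul, h]

lemma HasMomentum.unique {φ ψ : WeakDual ℂ (Weyl d)} {p : E d} (hφ : HasMomentum φ p)
    (hψ : HasMomentum ψ p) : φ = ψ :=
  ext_monomials fun α β => (hφ α β).trans (hψ α β).symm

/-! ### Action of the translations on monomials -/

lemma coe_u_zero : (Weyl.u (0 : E d) : Weyl d) = 1 := rfl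

lemma coe_v_zero : (Weyl.v (0 : E d) : Weyl d) = 1 := rfl

lemma coe_u_add (α α' : E d) : (Weyl.u (α + α') : Weyl d) = Weyl.u α * Weyl.u α' := by
  rw [Weyl.u_add]; rfl

lemma coe_v_add (β β' : E d) : (Weyl.v (β + β') : Weyl d) = Weyl.v β * Weyl.v β' := by
  rw [Weyl.v_add]; rfl

lemma star_coe_u (α : E d) : star (Weyl.u α : Weyl d) = Weyl.u (-α) := by
  rw [← Unitary.coe_star, Weyl.star_u]

lemma star_coe_v (β : E d) : star (Weyl.v β : Weyl d) = Weyl.v (-β) := by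
  rw [← Unitary.coe_star, Weyl.star_v]

lemma v_mul_u (α β : E d) : (Weyl.v β : Weyl d) * (Weyl.u α : Weyl d) =
    phase (-(inner ℝ α β)) • ((Weyl.u α : Weyl d) * (Weyl.v β : Weyl d)) := by
  rw [Weyl.u_mul_v, smul_smul, ← phase_add, neg_add_cancel, phase_zero, one_smul]

lemma θ_monomial (γ α β : E d) :
    Weyl.θ γ ((Weyl.u α : Weyl d) * (Weyl.v β : Weyl d)) =
      phase (inner ℝ γ β) • ((Weyl.u α : Weyl d) * (Weyl.v β : Weyl d)) := by
  rw [Weyl.θ, Unitary.conjStarAlgAut_apply, star_coe_u, mul_assoc, mul_assoc, v_mul_u,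
    mul_smul_comm, mul_smul_comm, ← mul_assoc (Weyl.u α : Weyl d), ← coe_u_add,
    ← mul_assoc, ← coe_u_add, add_neg_cancel_comm_assoc, inner_neg_left, neg_neg]

lemma τ_monomial (l α β : E d) :
    Weyl.τ l ((Weyl.u α : Weyl d) * (Weyl.v β : Weyl d)) =
      phase (-(inner ℝ α l)) • ((Weyl.u α : Weyl d) * (Weyl.v β : Weyl d)) := by
  rw [Weyl.τ, Unitary.conjStarAlgAut_apply, star_coe_v, ← mul_assoc, v_mul_u, smul_mul_assoc,
    smul_mul_assoc, mul_assoc, mul_assoc, ← coe_v_add, ← coe_v_add, add_neg_cancel_comm_assoc]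

lemma exists_phase_ne_one {α : E d} (hα : α ≠ 0) : ∃ β : E d, phase (inner ℝ α β) ≠ 1 := by
  -- Chosen so that α·β = π and the phase is -1.
  refine ⟨(Real.pi / ‖α‖ ^ 2) • α, ?_⟩
  rw [inner_smul_right, real_inner_self_eq_norm_sq,
    div_mul_cancel₀ _ (pow_ne_zero 2 (norm_ne_zero_iff.2 hα)), phase, mul_comm, Complex.exp_pi_mul_I]
  norm_num

/-! ### Pure translation-invariant states are characters in β -/

/-- A translation-invariant state vanishes on the monomials `u_α v_β` with `α ≠ 0`. -/
lemma apply_monomial_eq_zero {ω : WeakDual ℂ (Weyl d)} (h : ω ∈ translationInvariantStates d)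
    {α : E d} (hα : α ≠ 0) (β : E d) : ω ((Weyl.u α : Weyl d) * (Weyl.v β : Weyl d)) = 0 := by
  obtain ⟨l, hl⟩ := exists_phase_ne_one hα
  have h1 := DFunLike.congr_fun (h.2 (-l)) ((Weyl.u α : Weyl d) * (Weyl.v β : Weyl d))
  rw [pullback_apply, τ_monomial, map_smul, smul_eq_mul, inner_neg_right, neg_neg,
    mul_left_eq_self₀] at h1
  exact h1.resolve_left hl

/-- Compression of a translation-invariant state by `1 + z v_γ` with `|z| = 1`. -/
lemma compress_one_add {ω : WeakDual ℂ (Weyl d)} (h : ω ∈ translationInvariantStates d)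
    (z : ℂ) (hz : star z * z = 1) (γ α β : E d) :
    compress ω (1 + z • (Weyl.v γ : Weyl d)) ((Weyl.u α : Weyl d) * (Weyl.v β : Weyl d)) =
      2 * ω ((Weyl.u α : Weyl d) * (Weyl.v β : Weyl d)) +
      z * ω ((Weyl.u α : Weyl d) * (Weyl.v (β + γ) : Weyl d)) +
      star z * ω ((Weyl.u α : Weyl d) * (Weyl.v (β - γ) : Weyl d)) := by
  rw [compress_apply]
  have e : star (1 + z • (Weyl.v γ : Weyl d)) *
      ((Weyl.u α : Weyl d) * (Weyl.v β : Weyl d) * (1 + z • (Weyl.v γ : Weyl d))) =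
      (1 + phase (inner ℝ α γ)) • ((Weyl.u α : Weyl d) * (Weyl.v β : Weyl d)) +
      z • ((Weyl.u α : Weyl d) * (Weyl.v (β + γ) : Weyl d)) +
      (star z * phase (inner ℝ α γ)) • ((Weyl.u α : Weyl d) * (Weyl.v (β - γ) : Weyl d)) := by
    have e1 : (Weyl.v (-γ) : Weyl d) * ((Weyl.u α : Weyl d) * (Weyl.v β : Weyl d)) =
        phase (inner ℝ α γ) • ((Weyl.u α : Weyl d) * (Weyl.v (β - γ) : Weyl d)) := by
      rw [← mul_assoc, v_mul_u, smul_mul_assoc, mul_assoc, ← coe_v_add, inner_neg_right, neg_neg,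
        neg_add_eq_sub]
    have e2 : (Weyl.u α : Weyl d) * (Weyl.v (β - γ) : Weyl d) * (Weyl.v γ : Weyl d) =
        (Weyl.u α : Weyl d) * (Weyl.v β : Weyl d) := by
      rw [mul_assoc, ← coe_v_add, sub_add_cancel]
    simp only [star_add, star_one, star_smul, star_coe_v, add_mul, one_mul, mul_add, mul_one,
      smul_mul_assoc, mul_smul_comm, ← mul_assoc]
    rw [mul_assoc (Weyl.v (-γ) : Weyl d), e1, smul_mul_assoc, e2, coe_v_add, mul_assoc]
    rw [smul_add, smul_smul z, mul_comm z, hz, one_smul, add_smul, one_smul, mul_smul]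
    abel
  rw [e]
  simp only [map_add, map_smul, smul_eq_mul]
  -- The phases exp(i α·γ) are invisible to ω: they equal 1 for α = 0, and otherwise they multiply
  -- zero.
  by_cases hα : α = 0
  · subst hα
    rw [inner_zero_left, phase_zero]
    ring
  · simp only [apply_monomial_eq_zero h hα, mul_zero, add_zero]

/-- The restriction of a pure translation-invariant state to the `v_β` is a character. -/
lemma apply_v_add {ω : WeakDual ℂ (Weyl d)} (h : ω ∈ translationInvariantStates d)
    (hp : ω ∈ pureStates (Weyl d)) (β γ : E d) :
    ω (Weyl.v (β + γ) : Weyl d) = ω (Weyl.v β : Weyl d) * ω (Weyl.v γ : Weyl d) := by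
  have key : ∀ z : ℂ, star z * z = 1 →
      z * ω (Weyl.v (β + γ) : Weyl d) + star z * ω (Weyl.v (β - γ) : Weyl d) =
        (z * ω (Weyl.v γ : Weyl d) + star z * ω (Weyl.v (-γ) : Weyl d)) *
          ω (Weyl.v β : Weyl d) := by
    intro z hz
    have hz' : star (-z) * (-z) = 1 := by rw [star_neg, neg_mul_neg, hz]
    have hpos : ∀ w : ℂ, IsPositive
        ((4⁻¹ : ℝ) • compress ω (1 + w • (Weyl.v γ : Weyl d))) := fun w a =>
      smul_nonneg (by norm_num : (0 : ℝ) ≤ 4⁻¹) (IsPositive.compress (φ := ω) h.1.2 _ a)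
    -- The terms linear in z and in its conjugate cancel between z and -z, leaving 2ω + 2ω; hence
    -- the factor 1/4.
    have hsum : (4⁻¹ : ℝ) • compress ω (1 + z • (Weyl.v γ : Weyl d)) +
        (4⁻¹ : ℝ) • compress ω (1 + (-z) • (Weyl.v γ : Weyl d)) = ω := by
      refine ext_monomials fun α β => ?_
      change (4⁻¹ : ℝ) • compress ω (1 + z • (Weyl.v γ : Weyl d)) _ +
        (4⁻¹ : ℝ) • compress ω (1 + (-z) • (Weyl.v γ : Weyl d)) _ = _
      rw [compress_one_add h z hz, compress_one_add h (-z) hz', star_neg]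
      simp only [Complex.real_smul, Complex.ofReal_inv, Complex.ofReal_ofNat]
      ring
    have hmul := eq_smul_of_mem_pureStates hp (hpos z) (hpos (-z))
      (fun a => DFunLike.congr_fun hsum a) (Weyl.v β : Weyl d)
    change (4⁻¹ : ℝ) • compress ω (1 + z • (Weyl.v γ : Weyl d)) (Weyl.v β : Weyl d) =
      (4⁻¹ : ℝ) • compress ω (1 + z • (Weyl.v γ : Weyl d)) 1 * _ at hmul
    have h1 := compress_one_add h z hz γ 0 β
    have h2 := compress_one_add h z hz γ 0 0
    simp only [coe_u_zero, coe_v_zero, one_mul, zero_add, zero_sub, h.1.1] at h1 h2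
    rw [h1, h2] at hmul
    simp only [Complex.real_smul, Complex.ofReal_inv, Complex.ofReal_ofNat] at hmul
    linear_combination 4 * hmul
  -- The choices z = 1 and z = i separate the contributions of β + γ and β - γ.
  have k1 := key 1 (by simp)
  have k2 := key Complex.I (by simp)
  simp only [star_one, one_mul, Complex.star_def, Complex.conj_I] at k1 k2
  linear_combination k1 / 2 - Complex.I * k2 / 2 + (ω (Weyl.v (β + γ) : Weyl d) -
    ω (Weyl.v (β - γ) : Weyl d) - (ω (Weyl.v γ : Weyl d) - ω (Weyl.v (-γ) : Weyl d)) *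
    ω (Weyl.v β : Weyl d)) / 2 * Complex.I_mul_I

lemma exists_hasMomentum {ω : WeakDual ℂ (Weyl d)} (h : ω ∈ planeWaveStates d) :
    ∃ p, HasMomentum ω p := by
  obtain ⟨hinv, hp, hs⟩ := h
  have hadd := apply_v_add hinv hp
  -- The product ω(v_β) ω(v_(-β)) equals ω(1) = 1 while both factors have modulus at most one.
  have hnorm : ∀ β : E d, ‖ω (Weyl.v β : Weyl d)‖ = 1 := by
    intro β
    have h1 := hadd β (-β)
    rw [add_neg_cancel, coe_v_zero, hinv.1.1] at h1
    have h2 := congrArg norm h1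
    rw [norm_one, norm_mul] at h2
    have h3 := norm_apply_unitary_le_one hinv.1 (Weyl.v β)
    have h4 := norm_apply_unitary_le_one hinv.1 (Weyl.v (-β))
    nlinarith [norm_nonneg (ω (Weyl.v β : Weyl d))]
  obtain ⟨p, hp⟩ := exists_eq_phase_inner (f := fun β : E d => ω (Weyl.v β : Weyl d))
    (fun x => by simpa only [coe_u_zero, one_mul] using hs 0 x) hadd hnorm
  refine ⟨p, fun α β => ?_⟩
  split_ifs with hα
  · rw [hα, coe_u_zero, one_mul]
    exact hp β
  · exact apply_monomial_eq_zero hinv hα β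

/-! ### Momentum states are pure plane waves -/

/-- A state with the values of `ω_p` on the `v_β` is `ω_p`. -/
lemma hasMomentum_of_apply_v {φ : WeakDual ℂ (Weyl d)} (h : φ ∈ states (Weyl d)) {p : E d}
    (hv : ∀ β : E d, φ (Weyl.v β : Weyl d) = phase (-(inner ℝ p β))) : HasMomentum φ p := by
  have hmul := fun β => apply_mul_unitary h (Weyl.v β) (by rw [hv, norm_phase])
  intro α β
  split_ifs with hα
  · rw [hα, coe_u_zero, one_mul, hv]
  · obtain ⟨γ, hγ⟩ := exists_phase_ne_one hα
    -- Both orders of u_α and v_γ have the value φ(v_γ) φ(u_α), yet the Weyl relation makes them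
    -- differ by a phase other than 1. As φ(v_γ) ≠ 0, this forces φ(u_α) = 0.
    have h1 := congrArg φ (Weyl.u_mul_v α γ)
    rw [map_smul, (hmul γ _).1, (hmul γ _).2, smul_eq_mul, eq_comm, mul_left_eq_self₀] at h1
    have h2 := h1.resolve_left hγ
    rw [mul_eq_zero, ← norm_eq_zero, hv, norm_phase] at h2
    rw [(hmul β _).1, h2.resolve_left one_ne_zero, mul_zero]

lemma HasMomentum.apply_v {ω : WeakDual ℂ (Weyl d)} {p : E d} (h : HasMomentum ω p) (β : E d) :
    ω (Weyl.v β : Weyl d) = phase (-(inner ℝ p β)) := by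
  have := h 0 β
  rwa [coe_u_zero, one_mul, if_pos rfl] at this

/-- If a convex combination of two numbers of modulus at most one has modulus one, then all three
numbers agree. -/
lemma eq_of_convex_combination {x y c : ℂ} {s t : ℝ} (hs : 0 < s) (ht : 0 < t) (hst : s + t = 1)
    (hx : ‖x‖ ≤ 1) (hy : ‖y‖ ≤ 1) (hc : ‖c‖ = 1) (h : s • x + t • y = c) : x = c ∧ y = c := by
  have hext : c ∈ (Metric.closedBall (0 : ℂ) 1).extremePoints ℝ :=
    StrictConvexSpace.sphere_subset_extremePoints_closedBall 0 one_ne_zero (by simpa using hc)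
  exact (mem_extremePoints.1 hext).2 x (by simpa using hx) y (by simpa using hy)
    ⟨s, t, hs, ht, hst, h⟩

/-- The values at v_β lie on the unit circle, whose points are extreme in the closed disc. Both
components of a convex decomposition therefore share these values, and the values determine the
state. -/
lemma HasMomentum.mem_pureStates {ω : WeakDual ℂ (Weyl d)} {p : E d} (h : HasMomentum ω p)
    (hω : ω ∈ states (Weyl d)) : ω ∈ pureStates (Weyl d) := by
  refine mem_extremePoints.2 ⟨hω, fun φ hφ ψ hψ ⟨s, t, hs, ht, hst, e⟩ => ?_⟩
  have key : ∀ β : E d, φ (Weyl.v β : Weyl d) = ω (Weyl.v β : Weyl d) ∧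
      ψ (Weyl.v β : Weyl d) = ω (Weyl.v β : Weyl d) := fun β =>
    eq_of_convex_combination hs ht hst (norm_apply_unitary_le_one hφ _)
      (norm_apply_unitary_le_one hψ _) (by rw [h.apply_v, norm_phase])
      (DFunLike.congr_fun e (Weyl.v β : Weyl d))
  exact ⟨(hasMomentum_of_apply_v hφ fun β => by rw [(key β).1, h.apply_v]).unique h,
    (hasMomentum_of_apply_v hψ fun β => by rw [(key β).2, h.apply_v]).unique h⟩

lemma continuous_phase : Continuous phase := by
  unfold phase
  fun_prop

lemma HasMomentum.mem_planeWaveStates {ω : WeakDual ℂ (Weyl d)} {p : E d} (h : HasMomentum ω p)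
    (hω : ω ∈ states (Weyl d)) : ω ∈ planeWaveStates d := by
  refine ⟨⟨hω, fun l => ext_monomials fun α β => ?_⟩, h.mem_pureStates hω, fun α β => ?_⟩
  · rw [pullback_apply, τ_monomial, map_smul, h, smul_eq_mul]
    split_ifs with hα
    · rw [hα, inner_zero_left, neg_zero, phase_zero, one_mul]
    · rw [mul_zero]
  · simp only [h α, inner_smul_right]
    split_ifs
    · exact continuous_phase.comp (by fun_prop)
    · exact continuous_const

/-- The plane-wave state of momentum `p`, as a vector state on `ℓ²(ℝ^d)`. -/
def planeWave (p : E d) : WeakDual ℂ (Weyl d) :=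
  vectorFunctional (momentumRep d) (momentumVector p)

lemma planeWave_mem_states (p : E d) : planeWave p ∈ states (Weyl d) :=
  vectorFunctional_mem_states (momentumRep d) (norm_momentumVector p)

/-- The operator of u_α v_β sends e_p to exp(-i p·β) e_(p+α), which is orthogonal to e_p unless α =
0. -/
lemma hasMomentum_planeWave (p : E d) : HasMomentum (planeWave p) p := by
  intro α β
  have h1 : (Weyl.u α : Weyl d) * (Weyl.v β : Weyl d) = Weyl.of (WeylStar.mono (α, β) 1) := by
    rw [of_mono, one_smul]
  rw [h1, planeWave, vectorFunctional_of, momentumRep_mono, one_smul,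
    LinearIsometry.coe_toContinuousLinearMap, inner_momentumVector, weightedShift_apply]
  split_ifs with hα
  · rw [hα, sub_zero, momentumVector_apply_self, mul_one]
  · rw [momentumVector_apply_ne (by simpa using hα), mul_zero]

/-! ### The path of momentum translations -/

lemma states_pullback {ω : WeakDual ℂ (Weyl d)} (hω : ω ∈ states (Weyl d))
    (f : Weyl d ≃⋆ₐ[ℂ] Weyl d) : pullback ω f ∈ states (Weyl d) := by
  refine ⟨?_, fun a => ?_⟩
  · rw [pullback_apply, map_one, hω.1]
  · rw [pullback_apply, map_mul, map_star]
    exact hω.2 _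

lemma HasMomentum.pullback_θ {ω : WeakDual ℂ (Weyl d)} {p : E d} (h : HasMomentum ω p)
    (γ : E d) : HasMomentum (pullback ω (Weyl.θ γ)) (p - γ) := by
  intro α β
  rw [pullback_apply, θ_monomial, map_smul, h, smul_eq_mul]
  split_ifs
  · rw [← phase_add, inner_sub_left]
    congr 1
    ring
  · rw [mul_zero]

/-- A family of star-automorphisms is strongly continuous if it is so on the monomials. -/
lemma continuous_of_monomials {X : Type*} [TopologicalSpace X] (f : X → Weyl d ≃⋆ₐ[ℂ] Weyl d)
    (h : ∀ α β : E d, Continuous fun t => f t ((Weyl.u α : Weyl d) * (Weyl.v β : Weyl d)))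
    (a : Weyl d) : Continuous fun t => f t a := by
  induction a using Weyl.induction_mono with
  | hP =>
    -- Automorphisms are isometric, so approximating a by b approximates the whole orbit map
    -- uniformly in t, and uniform limits preserve continuity.
    refine isClosed_of_closure_subset fun a ha => ?_
    refine continuous_of_uniform_approx_of_continuous fun U hU => ?_
    obtain ⟨ε, hε, hεU⟩ := Metric.mem_uniformity_dist.1 hU
    obtain ⟨b, hb, hab⟩ := Metric.mem_closure_iff.1 ha ε hε
    refine ⟨fun t => f t b, hb, fun t => hεU ?_⟩
    rwa [(StarAlgEquiv.isometry (f t)).dist_eq]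
  | h0 => simpa only [map_zero] using continuous_const
  | hadd a b ha hb => simp only [map_add]; exact ha.add hb
  | hm α β c => simp only [map_smul]; exact (h α β).const_smul c

lemma continuous_θ_smul (p : E d) (a : Weyl d) :
    Continuous fun t : unitInterval => Weyl.θ ((t : ℝ) • p) a := by
  refine continuous_of_monomials (fun t : unitInterval => Weyl.θ ((t : ℝ) • p)) (fun α β => ?_) a
  simp only [θ_monomial, real_inner_smul_left]
  exact (continuous_phase.comp (by fun_prop)).smul continuous_const

/-- At time t the state has momentum p - tp, so the path never leaves the plane waves; its weak-star
continuity is inherited from strong continuity. -/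
lemma implementsEquivalence_θ (p : E d) :
    ImplementsEquivalence (planeWaveStates d) (planeWave p) (planeWave 0)
      (fun t => Weyl.θ ((t : ℝ) • p)) where
  strongly_continuous := continuous_θ_smul p
  mem t := ((hasMomentum_planeWave p).pullback_θ _).mem_planeWaveStates
    (states_pullback (planeWave_mem_states p) _)
  continuous := WeakDual.continuous_of_continuous_eval fun a =>
    (map_continuous (planeWave p)).comp (continuous_θ_smul p a)
  source := ((hasMomentum_planeWave p).pullback_θ _).unique (by simpa using hasMomentum_planeWave p)
  target := ((hasMomentum_planeWave p).pullback_θ _).unique (by simpa using hasMomentum_planeWave 0)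

lemma planeWave_mem_planeWaveStates (p : E d) : planeWave p ∈ planeWaveStates d :=
  (hasMomentum_planeWave p).mem_planeWaveStates (planeWave_mem_states p)

lemma range_planeWave : Set.range planeWave = planeWaveStates d := by
  ext ω
  constructor
  · rintro ⟨p, rfl⟩
    exact planeWave_mem_planeWaveStates p
  · intro h
    obtain ⟨p, hp⟩ := exists_hasMomentum h
    exact ⟨p, (hasMomentum_planeWave p).unique hp⟩

end PlaneWaves

end WeylCCR

end

open WeylCCR in
theorem mainTheorem11 (d : ℕ) :
    ∃ ω : EuclideanSpace ℝ (Fin d) → WeakDual ℂ (Weyl d),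
      (∀ p, HasMomentum (ω p) p) ∧
      Set.range ω = planeWaveStates d ∧
      ∀ p, AutomorphicallyEquivalent (planeWaveStates d) (ω p) (ω 0) ∧
        ImplementsEquivalence (planeWaveStates d) (ω p) (ω 0)
          (fun t => Weyl.θ ((t : ℝ) • p)) :=
  ⟨planeWave, hasMomentum_planeWave, range_planeWave, fun p =>
    ⟨⟨planeWave_mem_planeWaveStates p, planeWave_mem_planeWaveStates 0, _,
      implementsEquivalence_θ p⟩, implementsEquivalence_θ p⟩⟩
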